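/- Let $k\ge 3$ and let $B_k$ be the banana graph, i.e. the topological graph with two vertices and $k$ edges, each connecting these two vertices. Let $$\mathrm{Conf}_2(B_k)=\{(x_1,x_2)\in B_k\times B_k \mid x_1\neq x_2\}$$ be its ordered two-point configuration space, with the subspace topology. Then $\mathrm{Conf}_2(B_k)$ is homotopy equivalent to a connected finite graph (a finite CW complex of dimension at most one; loops and multiple edges are allowed) whose first Betti number, i.e. the rank of its first integral homology group, is at least $k-1$. -/

import Mathlib

/-- A finite graph: finitely many vertices and finitely many edges, each edge with an (auxiliary)
orientation from `src e` to `tgt e`. Loops and multiple edges are allowed. -/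
structure FiniteGraph where
  V : Type
  E : Type
  [finiteV : Finite V]
  [finiteE : Finite E]
  src : E → V
  tgt : E → V

attribute [instance] FiniteGraph.finiteV FiniteGraph.finiteE

namespace FiniteGraph

/-- The vertices form a discrete set. -/
instance (G : FiniteGraph) : TopologicalSpace G.V := ⊥

/-- The edges are indexed by a discrete set. -/
instance (G : FiniteGraph) : TopologicalSpace G.E := ⊥

instance (G : FiniteGraph) : DiscreteTopology G.V := ⟨rfl⟩

instance (G : FiniteGraph) : DiscreteTopology G.E := ⟨rfl⟩

/-- The gluing of the two ends of each edge `e × [0,1]` to the vertices. -/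
inductive Glue (G : FiniteGraph) : G.V ⊕ G.E × unitInterval → G.V ⊕ G.E × unitInterval → Prop
  | src (e : G.E) : Glue G (Sum.inr (e, 0)) (Sum.inl (G.src e))
  | tgt (e : G.E) : Glue G (Sum.inr (e, 1)) (Sum.inl (G.tgt e))

/-- The underlying topological space of a graph, a finite CW complex of dimension at most one:
the quotient of `V ⊔ E × [0,1]` by the equivalence relation generated by `(e, 0) ∼ src e` and
`(e, 1) ∼ tgt e`, with the quotient topology. -/
def Space (G : FiniteGraph) : Type := Quot G.Glue

instance (G : FiniteGraph) : TopologicalSpace G.Space :=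
  inferInstanceAs (TopologicalSpace (Quot G.Glue))

/-- The boundary map `C₁ → C₀`, `e ↦ tgt e - src e`, of the cellular chain complex of the graph. -/
noncomputable def boundary (G : FiniteGraph) : (G.E →₀ ℤ) →ₗ[ℤ] (G.V →₀ ℤ) :=
  Finsupp.linearCombination ℤ
    (fun e => Finsupp.single (G.tgt e) (1 : ℤ) - Finsupp.single (G.src e) (1 : ℤ))

/-- The first Betti number of a finite graph: the rank of `H₁ = ker (∂ : C₁ → C₀)`. (There are no
2-cells, so the group of 1-boundaries is zero.) -/
noncomputable def firstBetti (G : FiniteGraph) : ℕ :=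
  Module.finrank ℤ (LinearMap.ker G.boundary)

/-- The banana graph `B_k`: two vertices connected by `k` edges. -/
def banana (k : ℕ) : FiniteGraph where
  V := Fin 2
  E := Fin k
  src := fun _ => 0
  tgt := fun _ => 1

end FiniteGraph

/-- The `n`-th ordered configuration space of a space `X`: the injective maps
`{1, …, n} → X`, with the subspace topology from `X ^ n`. -/
abbrev Conf (n : ℕ) (X : Type) : Type := {x : Fin n → X // Function.Injective x}

/-! A configuration is a point `(s, t)` in the square of an ordered pair of edges. For distinct
edges only the corners `(0, 0)` and `(1, 1)` are missing, and the square retracts onto its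
antidiagonal, the sides collapsing to the corners `(0, 1)` and `(1, 0)`. For equal edges the
diagonal is missing, and the two triangles collapse to these same corners. The straight-line motions
agree on glued sides, so the configuration space retracts onto a graph with two vertices and `k * (k
- 1)` edges, of Betti number at least `k * (k - 1) - 1`. The target of the motion is `level`;
`not_mix_eq` excludes collisions, `toConf_contract_congr` gives compatibility with the gluing, and
`nonempty_homotopyEquiv_of_isProperMap` descends to the quotient. -/

open Topology unitInterval

/-! ### Descent of homotopies along proper maps -/

/-- A homotopy equivalence of a quotient `X` of `W` (along a proper map) with a space `Y` that is a
deformation retract of `X`, described by data on `W`. -/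
theorem nonempty_homotopyEquiv_of_isProperMap {W X Y : Type*} [TopologicalSpace W]
    [TopologicalSpace X] [TopologicalSpace Y] (q : C(W, X)) (hq : IsProperMap q)
    (hs : Function.Surjective q) (F : C(W, Y)) (hF : ∀ a b, q a = q b → F a = F b)
    (g : C(Y, X)) (hg : ∀ y, ∃ w, q w = g y ∧ F w = y) (H : C(I × W, X))
    (hH : ∀ τ a b, q a = q b → H (τ, a) = H (τ, b)) (H0 : ∀ w, H (0, w) = g (F w))
    (H1 : ∀ w, H (1, w) = q w) : Nonempty (ContinuousMap.HomotopyEquiv X Y) := by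
  have hQ : IsQuotientMap q := hq.isClosedMap.isQuotientMap hq.continuous hs
  let f : C(X, Y) := hQ.lift F hF
  have hf : ∀ w, f (q w) = F w := fun w => DFunLike.congr_fun (hQ.lift_comp F hF) w
  let r : C(I × W, I × X) := (ContinuousMap.id I).prodMap q
  -- Properness is what survives the product with `I`; a product of quotient maps need not be a
  -- quotient map.
  have hr : IsProperMap r := isProperMap_id.prodMap hq
  have hR : IsQuotientMap r :=
    hr.isClosedMap.isQuotientMap hr.continuous (Function.surjective_id.prodMap hs)
  have hr' : ∀ a b, r a = r b → H a = H b := by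
    rintro ⟨τ, a⟩ ⟨τ', b⟩ h
    obtain ⟨h₁, h₂⟩ := Prod.ext_iff.1 h
    obtain rfl : τ = τ' := h₁
    exact hH τ a b h₂
  let K : C(I × X, X) := hR.lift H hr'
  have hK : ∀ τ w, K (τ, q w) = H (τ, w) := fun τ w =>
    DFunLike.congr_fun (hR.lift_comp H hr') (τ, w)
  refine ⟨⟨f, g, ⟨⟨K, fun x => ?_, fun x => ?_⟩⟩, ?_⟩⟩
  · obtain ⟨w, rfl⟩ := hs x
    simp only [ContinuousMap.toFun_eq_coe, ContinuousMap.comp_apply, hK, H0, hf]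
  · obtain ⟨w, rfl⟩ := hs x
    simp only [ContinuousMap.toFun_eq_coe, ContinuousMap.id_apply, hK, H1]
  · have : f.comp g = ContinuousMap.id Y := by
      ext y
      obtain ⟨w, h₁, h₂⟩ := hg y
      simp only [ContinuousMap.comp_apply, ContinuousMap.id_apply, ← h₁, hf, h₂]
    rw [this]

/-- The configuration space of two points is the complement of the diagonal in the square. -/
def confTwoHomeomorph (X : Type) [TopologicalSpace X] :
    Conf 2 X ≃ₜ ↥{p : X × X | p.1 ≠ p.2} where
  toFun x := ⟨(x.1 0, x.1 1), fun h => absurd (x.2 h) (by decide)⟩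
  invFun p := ⟨![p.1.1, p.1.2], by
    intro a b
    have h : p.1.1 ≠ p.1.2 := p.2
    fin_cases a <;> fin_cases b <;> simp [h, h.symm]⟩
  left_inv x := by
    ext a
    fin_cases a <;> rfl
  right_inv p := rfl
  continuous_toFun :=
    Continuous.subtype_mk (((continuous_apply 0).comp continuous_subtype_val).prodMk
      ((continuous_apply 1).comp continuous_subtype_val)) _
  continuous_invFun := by
    refine Continuous.subtype_mk (continuous_pi fun a => ?_) _
    fin_cases a
    · exact continuous_fst.comp continuous_subtype_val
    · exact continuous_snd.comp continuous_subtype_val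

/-! ### Functions on the square -/

namespace unitInterval

/-- The affine path from `a` to `b`. -/
def mix (τ a b : I) : I :=
  ⟨(1 - τ) * a + τ * b, by
    have h₁ := mul_nonneg (one_minus_nonneg τ) a.2.1
    have h₂ := mul_nonneg τ.2.1 b.2.1
    have h₃ := mul_le_mul_of_nonneg_left a.2.2 (one_minus_nonneg τ)
    have h₄ := mul_le_mul_of_nonneg_left b.2.2 τ.2.1
    constructor <;> linarith⟩

@[simp] theorem coe_mix (τ a b : I) : (mix τ a b : ℝ) = (1 - τ) * a + τ * b := rfl

@[simp] theorem mix_self (τ a : I) : mix τ a a = a := by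
  ext; simp only [coe_mix]; ring

@[simp] theorem mix_zero (a b : I) : mix 0 a b = a := by ext; simp

@[simp] theorem mix_one (a b : I) : mix 1 a b = b := by ext; simp

theorem continuous_mix : Continuous fun x : I × I × I => mix x.1 x.2.1 x.2.2 :=
  Continuous.subtype_mk (by fun_prop) _

/-- A function on the square without the corners `(0, 0)` and `(1, 1)` that is `0` on the sides
`s = 0` and `t = 1`, is `1` on the sides `s = 1` and `t = 0`, and is `s` at `(s, 1 - s)`. -/
noncomputable def crossRatio (s t : I) : ℝ :=
  √(s * (1 - t)) / (√(s * (1 - t)) + √(t * (1 - s)))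

theorem crossRatio_mem (s t : I) : crossRatio s t ∈ I := by
  have h₁ := Real.sqrt_nonneg ((s : ℝ) * (1 - t))
  have h₂ := Real.sqrt_nonneg ((t : ℝ) * (1 - s))
  exact ⟨by unfold crossRatio; positivity, div_le_one_of_le₀ (by linarith) (by linarith)⟩

theorem crossRatio_denom_ne_zero {s t : I} (h₀ : ¬(s = 0 ∧ t = 0)) (h₁ : ¬(s = 1 ∧ t = 1)) :
    √((s : ℝ) * (1 - t)) + √((t : ℝ) * (1 - s)) ≠ 0 := by
  have hs := s.2.1
  have ht := t.2.1
  have hs' := one_minus_nonneg s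
  have ht' := one_minus_nonneg t
  intro h
  rw [add_eq_zero_iff_of_nonneg (Real.sqrt_nonneg _) (Real.sqrt_nonneg _),
    Real.sqrt_eq_zero (mul_nonneg hs ht'), Real.sqrt_eq_zero (mul_nonneg ht hs'),
    mul_eq_zero, mul_eq_zero] at h
  simp only [Subtype.ext_iff, Set.Icc.coe_zero, Set.Icc.coe_one] at h₀ h₁
  rcases h with ⟨h | h, h' | h'⟩
  · exact h₀ ⟨h, h'⟩
  · linarith
  · linarith
  · exact h₁ ⟨by linarith, by linarith⟩

theorem crossRatio_eq_zero {s t : I} (h : s = 0 ∨ t = 1) : crossRatio s t = 0 := by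
  rcases h with rfl | rfl <;> simp [crossRatio]

theorem crossRatio_eq_one {s t : I} (h₀ : ¬(s = 0 ∧ t = 0)) (h₁ : ¬(s = 1 ∧ t = 1))
    (h : s = 1 ∨ t = 0) : crossRatio s t = 1 := by
  have := crossRatio_denom_ne_zero h₀ h₁
  unfold crossRatio
  rcases h with rfl | rfl <;> simpa using this

/-- The square roots in `crossRatio` serve this identity: on the antidiagonal they resolve to `s`
and `1 - s`, with sum `1`. Hence the graph is retracted onto exactly. -/
theorem crossRatio_symm (s : I) : crossRatio s (σ s) = s := by
  have h : √((s : ℝ) * s) = s := Real.sqrt_mul_self s.2.1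
  have h' : √((1 - s : ℝ) * (1 - s)) = 1 - s := Real.sqrt_mul_self (one_minus_nonneg s)
  simp [crossRatio, h, h']

end unitInterval

/-! ### Topology and Betti number of banana graphs -/

namespace FiniteGraph

/-- The graph with two vertices and edges from the first to the second indexed by `E`. -/
def bananaOn (E : Type) [Finite E] : FiniteGraph where
  V := Fin 2
  E := E
  src := fun _ => 0
  tgt := fun _ => 1

/-- Rank-nullity: every edge has the same boundary, so the image of the boundary map has rank at
most one. -/
theorem card_sub_one_le_firstBetti_bananaOn (E : Type) [Finite E] :
    Nat.card E - 1 ≤ (bananaOn E).firstBetti := by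
  have : Finite (bananaOn E).V := (bananaOn E).finiteV
  have : Finite (bananaOn E).E := (bananaOn E).finiteE
  have h := Submodule.finrank_quotient_add_finrank (LinearMap.ker (bananaOn E).boundary)
  rw [(bananaOn E).boundary.quotKerEquivRange.finrank_eq] at h
  have h₁ : Module.finrank ℤ ((bananaOn E).E →₀ ℤ) = Nat.card E := by
    have := Fintype.ofFinite (bananaOn E).E
    rw [Module.finrank_finsupp_self, ← Nat.card_eq_fintype_card]
    rfl
  have h₂ : Module.finrank ℤ (LinearMap.range (bananaOn E).boundary) ≤ 1 := by
    let v : (bananaOn E).V →₀ ℤ :=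
      Finsupp.single (1 : Fin 2) (1 : ℤ) - Finsupp.single (0 : Fin 2) (1 : ℤ)
    have : LinearMap.range (bananaOn E).boundary ≤ Submodule.span ℤ {v} := by
      rw [boundary, Finsupp.range_linearCombination, Submodule.span_le]
      rintro _ ⟨e, rfl⟩
      exact Submodule.mem_span_singleton_self v
    refine (Submodule.finrank_mono this).trans ((finrank_span_le_card _).trans ?_)
    simp
  rw [firstBetti]
  omega

section Banana

variable {E : Type} [Finite E]

/-- The point at height `s` on the edge `e`. -/
def bananaPoint (x : E × I) : (bananaOn E).Space := Quot.mk _ (Sum.inr x)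

/-- The height of a point. -/
def bananaHeight : (bananaOn E).Space → I :=
  Quot.lift (Sum.elim (fun v : Fin 2 => if v = 0 then 0 else 1) Prod.snd) (by
    rintro _ _ (e | e) <;> simp [bananaOn])

open Classical in
/-- A bump function on the edge `e`. -/
noncomputable def bananaBump (e : E) : (bananaOn E).Space → ℝ :=
  Quot.lift (Sum.elim (fun _ => 0) fun x => (if x.1 = e then 1 else 0) * (x.2 * (1 - x.2))) (by
    rintro _ _ (e | e) <;> simp)

open Classical in
theorem bananaBump_bananaPoint (e i : E) (s : I) :
    bananaBump e (bananaPoint (i, s)) = (if i = e then 1 else 0) * ((s : ℝ) * (1 - s)) :=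
  rfl

theorem eq_or_of_bananaBump_eq {i j : E} {s : I}
    (h : bananaBump i (bananaPoint (i, s)) = bananaBump i (bananaPoint (j, s))) :
    i = j ∨ s = 0 ∨ s = 1 := by
  classical
  by_contra! hc
  obtain ⟨h₁, h₂, h₃⟩ := hc
  have h' : (s : ℝ) * (1 - s) = 0 := by
    rw [bananaBump_bananaPoint, bananaBump_bananaPoint, if_pos rfl, if_neg h₁.symm] at h
    simpa only [one_mul, zero_mul] using h
  rcases mul_eq_zero.1 h' with h' | h'
  · exact h₂ (Subtype.ext h')
  · exact h₃ (Subtype.ext (by simp only [Set.Icc.coe_one]; linarith))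

/-- The height and the bump functions descend to the quotient and separate its points, so the
generated equivalence relation need not be analysed. -/
theorem bananaPoint_eq_iff {a b : E × I} :
    bananaPoint a = bananaPoint b ↔ a.2 = b.2 ∧ (a.1 = b.1 ∨ a.2 = 0 ∨ a.2 = 1) := by
  obtain ⟨i, s⟩ := a
  obtain ⟨j, t⟩ := b
  constructor
  · intro h
    obtain rfl : s = t := congrArg bananaHeight h
    refine ⟨rfl, ?_⟩
    have h' : bananaBump i (bananaPoint (i, s)) = bananaBump i (bananaPoint (j, s)) :=
      congrArg _ h
    exact eq_or_of_bananaBump_eq h'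
  · rintro ⟨h, h'⟩
    obtain rfl : s = t := h
    rcases h' with h' | h' | h'
    · obtain rfl : i = j := h'
      rfl
    · obtain rfl : s = 0 := h'
      exact (Quot.sound (Glue.src (G := bananaOn E) i)).trans
        (Quot.sound (Glue.src (G := bananaOn E) j)).symm
    · obtain rfl : s = 1 := h'
      exact (Quot.sound (Glue.tgt (G := bananaOn E) i)).trans
        (Quot.sound (Glue.tgt (G := bananaOn E) j)).symm

theorem surjective_bananaPoint [Nonempty E] : Function.Surjective (bananaPoint (E := E)) := by
  obtain ⟨e⟩ := ‹Nonempty E›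
  rintro ⟨v | x⟩
  · have hv : v = (0 : Fin 2) ∨ v = (1 : Fin 2) :=
      (by decide : ∀ u : Fin 2, u = 0 ∨ u = 1) v
    rcases hv with rfl | rfl
    · exact ⟨(e, 0), Quot.sound (Glue.src (G := bananaOn E) e)⟩
    · exact ⟨(e, 1), Quot.sound (Glue.tgt (G := bananaOn E) e)⟩
  · exact ⟨x, rfl⟩

theorem continuous_bananaHeight : Continuous (bananaHeight (E := E)) :=
  continuous_quot_lift _
    (continuous_sumElim.2 ⟨continuous_of_discreteTopology (α := (bananaOn E).V), continuous_snd⟩)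

theorem continuous_bananaBump (e : E) : Continuous (bananaBump e) := by
  classical
  refine continuous_quot_lift _ (continuous_sumElim.2 ⟨continuous_const, ?_⟩)
  have h : Continuous fun x : (bananaOn E).E × I => if x.1 = e then (1 : ℝ) else 0 :=
    (continuous_of_discreteTopology (α := (bananaOn E).E)
      (f := fun a => if a = e then (1 : ℝ) else 0)).comp continuous_fst
  exact h.mul (by fun_prop)

instance [Nonempty E] : T2Space (bananaOn E).Space :=
  T2Space.of_injective_continuous
    (f := fun x => (bananaHeight x, fun e => bananaBump e x)) (by
      intro x y h
      obtain ⟨⟨i, s⟩, rfl⟩ := surjective_bananaPoint x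
      obtain ⟨⟨j, t⟩, rfl⟩ := surjective_bananaPoint y
      obtain ⟨h₁, h₂⟩ := Prod.ext_iff.1 h
      obtain rfl : s = t := h₁
      have h' : bananaBump i (bananaPoint (i, s)) = bananaBump i (bananaPoint (j, s)) :=
        congrFun h₂ i
      exact bananaPoint_eq_iff.2 ⟨rfl, eq_or_of_bananaBump_eq h'⟩)
    (continuous_bananaHeight.prodMk (continuous_pi fun e => continuous_bananaBump e))

variable [TopologicalSpace E] [DiscreteTopology E]

theorem continuous_bananaPoint : Continuous (bananaPoint (E := E)) := by
  -- The identity, between two discrete topologies on `E` that come from different instances.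
  let φ : C(E, (bananaOn E).E) := ⟨fun e => e, continuous_of_discreteTopology⟩
  have h : Continuous fun x : E × I => (Sum.inr (φ x.1, x.2) : (bananaOn E).V ⊕ _) :=
    continuous_inr.comp ((φ.continuous.comp continuous_fst).prodMk continuous_snd)
  exact continuous_quot_mk.comp h

theorem isProperMap_bananaPoint [Nonempty E] : IsProperMap (bananaPoint (E := E)) :=
  continuous_bananaPoint.isProperMap

instance [Nonempty E] : ConnectedSpace (bananaOn E).Space := by
  obtain ⟨e⟩ := ‹Nonempty E›
  have h : ∀ x, JoinedIn Set.univ (bananaPoint (e, 0)) (x : (bananaOn E).Space) := by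
    intro x
    have : Nonempty E := ⟨e⟩
    obtain ⟨⟨j, t⟩, rfl⟩ := surjective_bananaPoint x
    have h₀ : bananaPoint (e, 0) = bananaPoint (j, 0) :=
      bananaPoint_eq_iff.2 ⟨rfl, Or.inr (Or.inl rfl)⟩
    refine joinedIn_univ.2 ⟨⟨⟨fun τ => bananaPoint (j, τ * t), ?_⟩, ?_, ?_⟩⟩
    · exact continuous_bananaPoint.comp (by fun_prop)
    · simp [h₀]
    · simp
  have : PathConnectedSpace (bananaOn E).Space :=
    ⟨⟨bananaPoint (e, 0)⟩, fun x y =>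
      (joinedIn_univ.1 (h x)).symm.trans (joinedIn_univ.1 (h y))⟩
  infer_instance

end Banana

end FiniteGraph

/-! ### Retraction of the configuration space -/

namespace FiniteGraph

variable (k : ℕ)

/-- The ordered pairs of distinct edges of the banana graph. -/
abbrev EdgePairs : Type := {p : Fin k × Fin k // p.1 ≠ p.2}

theorem card_edgePairs : Nat.card (EdgePairs k) = k * k - k := by
  rw [Nat.card_eq_fintype_card, Fintype.card_subtype]
  have h := Finset.offDiag_card (Finset.univ : Finset (Fin k))
  rw [Finset.card_univ, Fintype.card_fin] at h
  rw [← h]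
  congr 1
  ext p
  simp [Finset.mem_offDiag]

/-- The pairs of (edge, height) coordinates of two distinct points. -/
abbrev ConfCoord : Type :=
  {w : (Fin k × I) × (Fin k × I) // bananaPoint w.1 ≠ bananaPoint w.2}

namespace ConfCoord

variable {k}

/-- The configuration with the given coordinates. -/
def toConf : C(ConfCoord k,
    ↥{p : (bananaOn (Fin k)).Space × (bananaOn (Fin k)).Space | p.1 ≠ p.2}) where
  toFun w := ⟨(bananaPoint w.1.1, bananaPoint w.1.2), w.2⟩
  continuous_toFun := Continuous.subtype_mk
    ((continuous_bananaPoint.comp (continuous_fst.comp continuous_subtype_val)).prodMk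
      (continuous_bananaPoint.comp (continuous_snd.comp continuous_subtype_val))) _

/-- The coordinate space is not compact, but it is the full preimage of the complement of the
diagonal, and properness restricts to preimages. -/
theorem isProperMap_toConf [NeZero k] : IsProperMap (toConf (k := k)) :=
  ((isProperMap_bananaPoint (E := Fin k)).prodMap
    (isProperMap_bananaPoint (E := Fin k))).restrictPreimage {p | p.1 ≠ p.2}

theorem surjective_toConf [NeZero k] : Function.Surjective (toConf (k := k)) := by
  rintro ⟨⟨x, y⟩, h⟩
  obtain ⟨a, rfl⟩ := surjective_bananaPoint x
  obtain ⟨b, rfl⟩ := surjective_bananaPoint y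
  exact ⟨⟨(a, b), h⟩, rfl⟩

theorem toConf_eq_iff {w w' : ConfCoord k} : toConf w = toConf w' ↔
    bananaPoint w.1.1 = bananaPoint w'.1.1 ∧ bananaPoint w.1.2 = bananaPoint w'.1.2 := by
  rw [Subtype.ext_iff, Prod.ext_iff]
  rfl

theorem not_zero (w : ConfCoord k) : ¬(w.1.1.2 = 0 ∧ w.1.2.2 = 0) := fun h =>
  w.2 (bananaPoint_eq_iff.2 ⟨h.1.trans h.2.symm, Or.inr (Or.inl h.1)⟩)

theorem not_one (w : ConfCoord k) : ¬(w.1.1.2 = 1 ∧ w.1.2.2 = 1) := fun h =>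
  w.2 (bananaPoint_eq_iff.2 ⟨h.1.trans h.2.symm, Or.inr (Or.inr h.1)⟩)

theorem height_ne (w : ConfCoord k) (h : w.1.1.1 = w.1.2.1) : w.1.1.2 ≠ w.1.2.2 := fun h' =>
  w.2 (bananaPoint_eq_iff.2 ⟨h', Or.inl h⟩)

/-- The height of the image of a configuration in the graph of pairs of edges: for points on the
same edge it is `0` or `1` according to their order. -/
noncomputable def level (w : ConfCoord k) : I :=
  if w.1.1.1 = w.1.2.1 then if w.1.1.2 < w.1.2.2 then 0 else 1
  else ⟨crossRatio w.1.1.2 w.1.2.2, crossRatio_mem _ _⟩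

theorem level_eq_zero (w : ConfCoord k) (h : w.1.1.2 = 0 ∨ w.1.2.2 = 1) : level w = 0 := by
  unfold level
  split_ifs with h₁ h₂
  · rfl
  · refine absurd (lt_of_le_of_ne ?_ (w.height_ne h₁)) h₂
    rcases h with h | h <;> rw [h]
    exacts [nonneg', le_one']
  · exact Subtype.ext (crossRatio_eq_zero h)

theorem level_eq_one (w : ConfCoord k) (h : w.1.1.2 = 1 ∨ w.1.2.2 = 0) : level w = 1 := by
  unfold level
  split_ifs with h₁ h₂
  · refine absurd h₂ (not_lt.2 ?_)
    rcases h with h | h <;> rw [h]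
    exacts [le_one', nonneg']
  · rfl
  · exact Subtype.ext (crossRatio_eq_one w.not_zero w.not_one h)

theorem level_eq_zero_or_one (w : ConfCoord k) (h : w.1.1.1 = w.1.2.1) :
    level w = 0 ∨ level w = 1 := by
  rw [level, if_pos h]
  split_ifs <;> simp

/-- On a common edge the heights differ, so the level is locally constant there; on distinct edges
the denominator vanishes only at the two excluded corners. -/
theorem continuous_level : Continuous (level (k := k)) := by
  have hs : Continuous fun w : ConfCoord k => w.1.1.2 := by fun_prop
  have ht : Continuous fun w : ConfCoord k => w.1.2.2 := by fun_prop
  have he : Continuous fun w : ConfCoord k => (w.1.1.1, w.1.2.1) := by fun_prop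
  have hlt : IsOpen {w : ConfCoord k | w.1.1.2 < w.1.2.2} := isOpen_lt hs ht
  have hgt : IsOpen {w : ConfCoord k | w.1.2.2 < w.1.1.2} := isOpen_lt ht hs
  have heq : IsOpen {w : ConfCoord k | w.1.1.1 = w.1.2.1} :=
    (isOpen_discrete {p : Fin k × Fin k | p.1 = p.2}).preimage he
  have hne : IsOpen {w : ConfCoord k | w.1.1.1 ≠ w.1.2.1} :=
    (isOpen_discrete {p : Fin k × Fin k | p.1 ≠ p.2}).preimage he
  refine continuous_iff_continuousAt.2 fun w => ?_
  by_cases h : w.1.1.1 = w.1.2.1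
  · rcases (w.height_ne h).lt_or_gt with h' | h'
    · refine (continuousAt_const (y := (0 : I))).congr ?_
      filter_upwards [heq.mem_nhds h, hlt.mem_nhds h'] with v h₁ h₂
      exact ((if_pos h₁).trans (if_pos h₂)).symm
    · refine (continuousAt_const (y := (1 : I))).congr ?_
      filter_upwards [heq.mem_nhds h, hgt.mem_nhds h'] with v h₁ h₂
      exact ((if_pos h₁).trans (if_neg (not_lt.2 (le_of_lt h₂)))).symm
  · have hc : Continuous fun v : ConfCoord k =>
        (⟨crossRatio v.1.1.2 v.1.2.2, crossRatio_mem _ _⟩ : I) := by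
      refine Continuous.subtype_mk ?_ _
      exact Continuous.div (by fun_prop) (by fun_prop) fun v =>
        crossRatio_denom_ne_zero v.not_zero v.not_one
    refine hc.continuousAt.congr ?_
    filter_upwards [hne.mem_nhds h] with v h₁
    exact (if_neg h₁).symm

/-- Two coordinates of the same configuration have the same heights, and the same edges except for
points at the vertices. -/
theorem eq_of_toConf_eq {w w' : ConfCoord k} (h : toConf w = toConf w') :
    w.1.1.2 = w'.1.1.2 ∧ w.1.2.2 = w'.1.2.2 ∧
    (w.1.1.1 = w'.1.1.1 ∨ w.1.1.2 = 0 ∨ w.1.1.2 = 1) ∧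
    (w.1.2.1 = w'.1.2.1 ∨ w.1.2.2 = 0 ∨ w.1.2.2 = 1) := by
  obtain ⟨h₁, h₂⟩ := toConf_eq_iff.1 h
  rw [bananaPoint_eq_iff] at h₁ h₂
  exact ⟨h₁.1, h₂.1, h₁.2, h₂.2⟩

theorem level_congr {w w' : ConfCoord k} (h : toConf w = toConf w') : level w = level w' := by
  obtain ⟨hs, ht, h₁, h₂⟩ := eq_of_toConf_eq h
  rcases h₁ with h₁ | h₁ | h₁
  · rcases h₂ with h₂ | h₂ | h₂
    · simp only [level, hs, ht, h₁, h₂]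
    · rw [level_eq_one w (Or.inr h₂), level_eq_one w' (Or.inr (ht ▸ h₂))]
    · rw [level_eq_zero w (Or.inr h₂), level_eq_zero w' (Or.inr (ht ▸ h₂))]
  · rw [level_eq_zero w (Or.inl h₁), level_eq_zero w' (Or.inl (hs ▸ h₁))]
  · rw [level_eq_one w (Or.inl h₁), level_eq_one w' (Or.inl (hs ▸ h₁))]

/-- An edge label is ambiguous only for a point at a vertex, and then the level is an endpoint,
where all edges of the target graph meet. -/
theorem edges_eq_or {w w' : ConfCoord k} (h : toConf w = toConf w') :
    (w.1.1.1 = w'.1.1.1 ∧ w.1.2.1 = w'.1.2.1) ∨ level w = 0 ∨ level w = 1 := by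
  obtain ⟨-, -, h₁, h₂⟩ := eq_of_toConf_eq h
  rcases h₁ with h₁ | h₁ | h₁
  · rcases h₂ with h₂ | h₂ | h₂
    · exact Or.inl ⟨h₁, h₂⟩
    · exact Or.inr (Or.inr (level_eq_one w (Or.inr h₂)))
    · exact Or.inr (Or.inl (level_eq_zero w (Or.inr h₂)))
  · exact Or.inr (Or.inl (level_eq_zero w (Or.inl h₁)))
  · exact Or.inr (Or.inr (level_eq_one w (Or.inl h₁)))

/-- The pair of edges of a configuration, or the pair `o` if the edges agree. -/
def edgePair (o : EdgePairs k) (p : Fin k × Fin k) : EdgePairs k :=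
  if h : p.1 ≠ p.2 then ⟨p, h⟩ else o

/-- The map from coordinates of configurations to the graph of pairs of edges. -/
noncomputable def toGraph (o : EdgePairs k) : C(ConfCoord k, (bananaOn (EdgePairs k)).Space) where
  toFun w := bananaPoint (edgePair o (w.1.1.1, w.1.2.1), level w)
  continuous_toFun := by
    refine continuous_bananaPoint.comp (Continuous.prodMk ?_ continuous_level)
    exact (continuous_of_discreteTopology (f := edgePair o)).comp
      (by fun_prop : Continuous fun w : ConfCoord k => (w.1.1.1, w.1.2.1))

theorem toGraph_congr (o : EdgePairs k) {w w' : ConfCoord k} (h : toConf w = toConf w') :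
    toGraph o w = toGraph o w' := by
  refine bananaPoint_eq_iff.2 ⟨level_congr h, ?_⟩
  rcases edges_eq_or h with ⟨h₁, h₂⟩ | h'
  · simp only [h₁, h₂, true_or]
  · exact Or.inr h'

/-- The coordinates on the antidiagonal of the square of a pair of edges. -/
def antidiagonal : C(EdgePairs k × I, ConfCoord k) where
  toFun x := ⟨((x.1.1.1, x.2), (x.1.1.2, σ x.2)), fun h => by
    obtain ⟨h₁, h₂ | h₂ | h₂⟩ := bananaPoint_eq_iff.1 h
    · exact x.1.2 h₂
    · have h₁ : x.2 = σ x.2 := h₁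
      have h₂ : x.2 = 0 := h₂
      simp [h₂] at h₁
    · have h₁ : x.2 = σ x.2 := h₁
      have h₂ : x.2 = 1 := h₂
      simp [h₂] at h₁⟩
  continuous_toFun := by
    have h : Continuous fun p : EdgePairs k => p.1 := continuous_subtype_val
    exact Continuous.subtype_mk (by fun_prop) _

theorem toGraph_antidiagonal (o : EdgePairs k) (x : EdgePairs k × I) :
    toGraph o (antidiagonal x) = bananaPoint x := by
  have h₁ : edgePair o (x.1.1.1, x.1.1.2) = x.1 := dif_pos x.1.2
  have h₂ : level (antidiagonal x) = x.2 :=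
    (if_neg x.1.2).trans (Subtype.ext (crossRatio_symm x.2))
  change bananaPoint (edgePair o (x.1.1.1, x.1.1.2), level (antidiagonal x)) = _
  rw [h₁, h₂]

theorem toConf_antidiagonal_congr {x y : EdgePairs k × I} (h : bananaPoint x = bananaPoint y) :
    toConf (antidiagonal x) = toConf (antidiagonal y) := by
  obtain ⟨h₁, h₂⟩ := bananaPoint_eq_iff.1 h
  refine toConf_eq_iff.2 ⟨bananaPoint_eq_iff.2 ⟨h₁, ?_⟩,
    bananaPoint_eq_iff.2 ⟨congrArg σ h₁, ?_⟩⟩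
  · exact h₂.imp_left fun h => congrArg (fun p : EdgePairs k => p.1.1) h
  · rcases h₂ with h | h | h
    · exact Or.inl (congrArg (fun p : EdgePairs k => p.1.2) h)
    · exact Or.inr (Or.inr (symm_eq_one.2 h))
    · exact Or.inr (Or.inl (symm_eq_zero.2 h))

/-- With `l` the level, the moved heights differ by `(1 - τ) * (s - t) + τ * (2 * l - 1)`. On a
common edge both terms have the same sign. At a vertex the heights sum to `(1 - τ) * (s + t) + τ`,
which is `0` or `2` only if `τ = 0`, when nothing has moved. -/
theorem not_mix_eq (τ : I) (w : ConfCoord k)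
    (h : mix τ w.1.1.2 (level w) = mix τ w.1.2.2 (σ (level w)))
    (h' : w.1.1.1 = w.1.2.1 ∨ mix τ w.1.1.2 (level w) = 0 ∨ mix τ w.1.1.2 (level w) = 1) :
    False := by
  have hs := w.1.1.2.2
  have ht := w.1.2.2.2
  have hl := (level w).2
  have hτ := τ.2
  have hτ' := one_minus_nonneg τ
  have key : (τ : ℝ) = 0 → w.1.1.2 = w.1.2.2 := fun h₀ => by
    obtain rfl : τ = 0 := Subtype.ext h₀
    simpa only [mix_zero] using h
  rcases h' with h' | h' | h'
  · have hne := w.height_ne h'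
    have h₁ := congrArg Subtype.val h
    simp only [coe_mix, coe_symm_eq] at h₁
    refine hne (key ?_)
    rcases hne.lt_or_gt with hlt | hlt
    · rw [level, if_pos h', if_pos hlt, Set.Icc.coe_zero] at h₁
      have := mul_nonneg hτ' (sub_nonneg.2 (Subtype.coe_le_coe.2 hlt.le))
      linarith [hτ.1]
    · rw [level, if_pos h', if_neg hlt.not_gt, Set.Icc.coe_one] at h₁
      have := mul_nonneg hτ' (sub_nonneg.2 (Subtype.coe_le_coe.2 hlt.le))
      linarith [hτ.1]
  · have h₂ := congrArg Subtype.val (h.symm.trans h')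
    have h₁ := congrArg Subtype.val h'
    simp only [coe_mix, coe_symm_eq, Set.Icc.coe_zero] at h₁ h₂
    have h₀ : (τ : ℝ) = 0 := by
      linarith [mul_nonneg hτ' hs.1, mul_nonneg hτ' ht.1, hτ.1]
    rw [h₀] at h₁
    have hs₀ : w.1.1.2 = 0 := Subtype.ext (by simpa using h₁)
    exact w.not_zero ⟨hs₀, (key h₀).symm.trans hs₀⟩
  · have h₂ := congrArg Subtype.val (h.symm.trans h')
    have h₁ := congrArg Subtype.val h'
    simp only [coe_mix, coe_symm_eq, Set.Icc.coe_one] at h₁ h₂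
    have h₀ : (τ : ℝ) = 0 := by
      linarith [mul_nonneg hτ' (sub_nonneg.2 hs.2), mul_nonneg hτ' (sub_nonneg.2 ht.2), hτ.1]
    rw [h₀] at h₁
    have hs₁ : w.1.1.2 = 1 := Subtype.ext (by simpa using h₁)
    exact w.not_one ⟨hs₁, (key h₀).symm.trans hs₁⟩

/-- The motion of coordinates towards the antidiagonal. -/
noncomputable def contract : C(I × ConfCoord k, ConfCoord k) where
  toFun x := ⟨((x.2.1.1.1, mix x.1 x.2.1.1.2 (level x.2)),
    (x.2.1.2.1, mix x.1 x.2.1.2.2 (σ (level x.2)))), by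
      rw [Ne, bananaPoint_eq_iff]
      exact fun h => not_mix_eq x.1 x.2 h.1 h.2⟩
  continuous_toFun := by
    have hl : Continuous fun x : I × ConfCoord k => level x.2 :=
      continuous_level.comp continuous_snd
    have h₁ := continuous_mix.comp (continuous_fst.prodMk
      ((by fun_prop : Continuous fun x : I × ConfCoord k => x.2.1.1.2).prodMk hl))
    have h₂ := continuous_mix.comp (continuous_fst.prodMk
      ((by fun_prop : Continuous fun x : I × ConfCoord k => x.2.1.2.2).prodMk
        (continuous_symm.comp hl)))
    refine Continuous.subtype_mk (Continuous.prodMk (Continuous.prodMk ?_ h₁)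
      (Continuous.prodMk ?_ h₂)) _ <;> fun_prop

/-- A point at a vertex stays there, because the level sends it to its own height; so its ambiguous
edge label does no harm. -/
theorem toConf_contract_congr (τ : I) {w w' : ConfCoord k} (h : toConf w = toConf w') :
    toConf (contract (τ, w)) = toConf (contract (τ, w')) := by
  have hl := level_congr h
  obtain ⟨hs, ht, h₁, h₂⟩ := eq_of_toConf_eq h
  refine toConf_eq_iff.2 ⟨bananaPoint_eq_iff.2 ⟨?_, ?_⟩, bananaPoint_eq_iff.2 ⟨?_, ?_⟩⟩
  · exact congrArg₂ (mix τ) hs hl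
  · refine h₁.imp_right (Or.imp (fun h => ?_) (fun h => ?_))
    · exact (congrArg₂ (mix τ) h (level_eq_zero w (Or.inl h))).trans (mix_self _ _)
    · exact (congrArg₂ (mix τ) h (level_eq_one w (Or.inl h))).trans (mix_self _ _)
  · exact congrArg₂ (mix τ) ht (congrArg σ hl)
  · refine h₂.imp_right (Or.imp (fun h => ?_) (fun h => ?_))
    · exact (congrArg₂ (mix τ) h
        (symm_eq_zero.2 (level_eq_one w (Or.inr h)))).trans (mix_self _ _)
    · exact (congrArg₂ (mix τ) h
        (symm_eq_one.2 (level_eq_zero w (Or.inr h)))).trans (mix_self _ _)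

theorem contract_zero (w : ConfCoord k) : contract (0, w) = w := by
  apply Subtype.ext
  change ((w.1.1.1, mix 0 w.1.1.2 (level w)), (w.1.2.1, mix 0 w.1.2.2 (σ (level w)))) = w.1
  rw [mix_zero, mix_zero]

theorem toConf_contract_one (o : EdgePairs k) (w : ConfCoord k) :
    toConf (contract (1, w)) =
      toConf (antidiagonal (edgePair o (w.1.1.1, w.1.2.1), level w)) := by
  refine toConf_eq_iff.2 ⟨bananaPoint_eq_iff.2 ⟨mix_one _ _, ?_⟩,
    bananaPoint_eq_iff.2 ⟨mix_one _ _, ?_⟩⟩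
  · change w.1.1.1 = (edgePair o (w.1.1.1, w.1.2.1)).1.1 ∨ mix 1 w.1.1.2 (level w) = 0 ∨
      mix 1 w.1.1.2 (level w) = 1
    rw [mix_one]
    by_cases h : w.1.1.1 = w.1.2.1
    · exact Or.inr (level_eq_zero_or_one w h)
    · left
      rw [edgePair, dif_pos h]
  · change w.1.2.1 = (edgePair o (w.1.1.1, w.1.2.1)).1.2 ∨ mix 1 w.1.2.2 (σ (level w)) = 0 ∨
      mix 1 w.1.2.2 (σ (level w)) = 1
    rw [mix_one, symm_eq_zero, symm_eq_one]
    by_cases h : w.1.1.1 = w.1.2.1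
    · exact Or.inr (level_eq_zero_or_one w h).symm
    · left
      rw [edgePair, dif_pos h]

end ConfCoord

open ConfCoord in
/-- The configuration space of two points in the banana graph is homotopy equivalent to the graph
with two vertices that are connected by an edge for every ordered pair of distinct edges. -/
theorem nonempty_homotopyEquiv_conf_two_banana {k : ℕ} (hk : 2 ≤ k) :
    Nonempty (ContinuousMap.HomotopyEquiv (Conf 2 (banana k).Space)
      (bananaOn (EdgePairs k)).Space) := by
  have : NeZero k := ⟨by omega⟩
  -- Any pair would do: it is used only for points on a common edge, where the level is `0` or `1`.
  let o : EdgePairs k := ⟨(⟨0, by omega⟩, ⟨1, by omega⟩), by simp⟩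
  have : Nonempty (EdgePairs k) := ⟨o⟩
  have hQ : IsQuotientMap (bananaPoint (E := EdgePairs k)) :=
    isProperMap_bananaPoint.isClosedMap.isQuotientMap continuous_bananaPoint
      surjective_bananaPoint
  let q : C(EdgePairs k × I, (bananaOn (EdgePairs k)).Space) := ⟨_, continuous_bananaPoint⟩
  have hc : ∀ x y, q x = q y → toConf (antidiagonal x) = toConf (antidiagonal y) :=
    fun _ _ => toConf_antidiagonal_congr
  let g := IsQuotientMap.lift (f := q) hQ (toConf.comp antidiagonal) hc
  have hg : ∀ x, g (bananaPoint x) = toConf (antidiagonal x) := fun x =>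
    DFunLike.congr_fun (IsQuotientMap.lift_comp (f := q) hQ (toConf.comp antidiagonal) hc) x
  -- `σ` reverses time: `contract` starts at the identity, while the required homotopy ends there.
  refine (nonempty_homotopyEquiv_of_isProperMap toConf isProperMap_toConf
    surjective_toConf (toGraph o) (fun _ _ => toGraph_congr o) g (fun y => ?_)
    (toConf.comp (contract.comp
      (ContinuousMap.prodMap ⟨σ, continuous_symm⟩ (ContinuousMap.id (ConfCoord k)))))
    (fun τ _ _ => toConf_contract_congr (σ τ)) (fun w => ?_) (fun w => ?_)).map
    (confTwoHomeomorph (bananaOn (Fin k)).Space).toHomotopyEquiv.trans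
  · obtain ⟨x, rfl⟩ := surjective_bananaPoint y
    exact ⟨antidiagonal x, (hg x).symm, toGraph_antidiagonal o x⟩
  · change toConf (contract (σ 0, w)) = g (bananaPoint (_, _))
    rw [hg, unitInterval.symm_zero, toConf_contract_one o]
  · change toConf (contract (σ 1, w)) = toConf w
    rw [unitInterval.symm_one, contract_zero]

end FiniteGraph

theorem mainTheorem8 (k : ℕ) (hk : 3 ≤ k) :
    ∃ G : FiniteGraph, ConnectedSpace G.Space ∧ k - 1 ≤ G.firstBetti ∧
      Nonempty (ContinuousMap.HomotopyEquiv (Conf 2 (FiniteGraph.banana k).Space) G.Space) := by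
  have : Nonempty (FiniteGraph.EdgePairs k) :=
    ⟨⟨(⟨0, by omega⟩, ⟨1, by omega⟩), by simp⟩⟩
  refine ⟨FiniteGraph.bananaOn (FiniteGraph.EdgePairs k), inferInstance,
    le_trans ?_ (FiniteGraph.card_sub_one_le_firstBetti_bananaOn _),
    FiniteGraph.nonempty_homotopyEquiv_conf_two_banana (by omega)⟩
  rw [FiniteGraph.card_edgePairs]
  -- The goal amounts to `2 * k ≤ k * k`, linear once `k * k` is treated as an atom.
  have : 3 * k ≤ k * k := Nat.mul_le_mul_right k hk
  omega
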